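/- An \emph{algebra} is a nonempty, possibly infinite set $A$ equipped with an arbitrary family of finitary operations. $\mathrm{Con}(A)$ denotes the set of congruences of $A$ ordered by inclusion, and $\mathrm{Princ}(A)\subseteq\mathrm{Con}(A)$ the set of principal congruences, i.e. those of the form $\mathrm{con}(a,b)$, the least congruence containing $(a,b)$, with $a,b\in A$. In particular, this applies to a lattice, regarded as an algebra with the operations $\vee,\wedge$. For a subset $Q$ of a finite lattice $D$, we say that $A$ \emph{represents the inclusion $Q\subseteq D$ by principal congruences} if there is an isomorphism $\varphi\colon \mathrm{Con}(A)\to D$ such that $\varphi(\mathrm{Princ}(A))=Q$. Let $J(D)$ be the set of nonzero join-irreducible elements of $D$. Corollary 1.4. Let $D$ be a finite (nonempty) distributive lattice. Suppose that for every $Q$ with $J(D)\cup\{0\}\subseteq Q\subseteq D$, the inclusion $Q\subseteq D$ is represented by the principal congruences of some algebra. Then for every $Q$ with $J(D)\cup\{0,1\}\subseteq Q\subseteq D$, the inclusion $Q\subseteq D$ is represented by the principal congruences of some finite lattice. -/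

import Mathlib

namespace PrincCong

/-- A congruence of an algebra `A` with (finitary) operations named by the function symbols of
`L`: an equivalence relation compatible with all operations. -/
@[ext]
structure AlgCon (L : FirstOrder.Language) (A : Type*) [L.Structure A] extends Setoid A where
  compat : ∀ {n : ℕ} (f : L.Functions n) (x y : Fin n → A),
    (∀ i, r (x i) (y i)) →
      r (FirstOrder.Language.Structure.funMap f x) (FirstOrder.Language.Structure.funMap f y)

theorem AlgCon.toSetoid_injective {L : FirstOrder.Language} {A : Type*} [L.Structure A] :
    Function.Injective (AlgCon.toSetoid : AlgCon L A → Setoid A) := by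
  rintro ⟨s, hs⟩ ⟨t, ht⟩ h
  cases h
  rfl

/-- `Con(A)`, ordered by inclusion. -/
instance AlgCon.instPartialOrder (L : FirstOrder.Language) (A : Type*) [L.Structure A] :
    PartialOrder (AlgCon L A) :=
  PartialOrder.lift AlgCon.toSetoid AlgCon.toSetoid_injective

/-- `Princ(A)`: the congruences of the form `con(a, b)`, the least congruence that
contains the pair `(a, b)`. -/
def AlgCon.principal (L : FirstOrder.Language) (A : Type*) [L.Structure A] : Set (AlgCon L A) :=
  {θ | ∃ a b : A, IsLeast {c : AlgCon L A | c.r a b} θ}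

theorem latticeCon_toSetoid_injective {K : Type*} [Lattice K] :
    Function.Injective (LatticeCon.toSetoid : LatticeCon K → Setoid K) := by
  rintro ⟨s, hs, hs'⟩ ⟨t, ht, ht'⟩ h
  cases h
  rfl

/-- `Con(K)` for a lattice `K`, ordered by inclusion. -/
instance latticeConPartialOrder (K : Type*) [Lattice K] : PartialOrder (LatticeCon K) :=
  PartialOrder.lift LatticeCon.toSetoid latticeCon_toSetoid_injective

/-- `Princ(K)` for a lattice `K`: the congruences of the form `con(a, b)`. -/
def latticePrincipal (K : Type*) [Lattice K] : Set (LatticeCon K) :=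
  {θ | ∃ a b : K, IsLeast {c : LatticeCon K | c.r a b} θ}

/-- The algebra `A` represents the inclusion `Q ⊆ D` by principal congruences. -/
def AlgRepresents (L : FirstOrder.Language) (A : Type*) [L.Structure A] {D : Type*} [Lattice D]
    (Q : Set D) : Prop :=
  ∃ φ : AlgCon L A ≃o D, Q = φ '' AlgCon.principal L A

/-- The lattice `K` represents the inclusion `Q ⊆ D` by principal congruences. -/
def LatticeRepresents (K : Type*) [Lattice K] {D : Type*} [Lattice D] (Q : Set D) : Prop :=
  ∃ φ : LatticeCon K ≃o D, Q = φ '' latticePrincipal K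

/-- `J₀(D)`: the nonzero join-irreducible elements together with `0`. -/
def J₀ (D : Type*) [Lattice D] [BoundedOrder D] : Set D := {x | SupIrred x} ∪ {⊥}

/-- `J⁺(D)`: the nonzero join-irreducible elements together with `0` and `1`. -/
def JPlus (D : Type*) [Lattice D] [BoundedOrder D] : Set D := {x | SupIrred x} ∪ {⊥, ⊤}

/-- Full A-representability: every `Q` with `J₀(D) ⊆ Q ⊆ D` is represented by the principal
congruences of some (possibly infinite) algebra of some type. -/
def FullyARepresentable.{u, w, d} (D : Type d) [Lattice D] [BoundedOrder D] : Prop :=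
  ∀ Q : Set D, J₀ D ⊆ Q →
    ∃ (L : FirstOrder.Language.{u, 0}) (_ : L.IsAlgebraic) (A : Type w) (_ : Nonempty A)
      (_ : L.Structure A), AlgRepresents L A Q

/-- Full FL-representability: every `Q` with `J⁺(D) ⊆ Q ⊆ D` is represented by the principal
congruences of some finite lattice. -/
def FullyFLRepresentable.{d} (D : Type d) [Lattice D] [BoundedOrder D] : Prop :=
  ∀ Q : Set D, JPlus D ⊆ Q →
    ∃ (K : Type) (_ : Finite K) (_ : Nonempty K) (_ : Lattice K), LatticeRepresents K Q

end PrincCong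

universe u w d

namespace PrincCong

open FirstOrder.Language (Structure)

/-! ### Congruences of an arbitrary algebra. -/

section Algebra

variable {L : FirstOrder.Language} {A : Type*} [L.Structure A]

/-! Only two kinds of `Q` in the hypothesis matter. With `Q = J₀ D ∪ {T}`, join `a` to `b`, where
`con(a, b)` is `T`, by a chain of steps in congruences from `J₀ D` below `T`. At the point `y` where
`con(a, y)` first becomes `T`, the value just before and the last step are two elements of `J₀ D`
with join `T`. With `Q = J₀ D`, write `⊤ = p ⊔ q`; primeness puts every pair of `A` in `p` or in
`q`, and a set is not the union of two proper equivalence relations, so `⊤ ∈ J₀ D`.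

These two facts suffice for a construction. Vertices are coloured by irreducibles, and cells are
faces with two levels per vertex, with a top adjoined to make a lattice. Raising a vertex raises
every smaller colour in its face, so congruences other than the total one collapse a down-set of
colours, that is, an element of `D`. A pair of cells on one base generates the join of the colours
where they differ; faces are chosen so that this join is in `Q`. Conversely `p ⊔ q ∈ Q`, if not `⊤`,
is generated by the two extreme cells on an edge. -/

theorem AlgCon.le_iff {c c' : AlgCon L A} : c ≤ c' ↔ ∀ x y, c.r x y → c'.r x y :=
  ⟨fun h _ _ hxy => h hxy, fun h x y hxy => h x y hxy⟩

/-- The least congruence containing `(a, b)`. -/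
def AlgCon.con (L : FirstOrder.Language) {A : Type*} [L.Structure A] (a b : A) : AlgCon L A where
  r x y := ∀ c : AlgCon L A, c.r a b → c.r x y
  iseqv :=
    ⟨fun x c _ => c.iseqv.refl x, fun h c hc => c.iseqv.symm (h c hc),
      fun h h' c hc => c.iseqv.trans (h c hc) (h' c hc)⟩
  compat f x y h c hc := c.compat f x y fun i => h i c hc

theorem AlgCon.isLeast_con (a b : A) : IsLeast {c : AlgCon L A | c.r a b} (AlgCon.con L a b) :=
  ⟨fun _ hc => hc, fun c hc => AlgCon.le_iff.2 fun _ _ h => h c hc⟩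

theorem AlgCon.con_le_iff {a b : A} {c : AlgCon L A} : AlgCon.con L a b ≤ c ↔ c.r a b :=
  ⟨fun h => AlgCon.le_iff.1 h _ _ (AlgCon.isLeast_con a b).1, fun h => (AlgCon.isLeast_con a b).2 h⟩

theorem AlgCon.con_mem_principal (a b : A) : AlgCon.con L a b ∈ AlgCon.principal L A :=
  ⟨a, b, AlgCon.isLeast_con a b⟩

/-- The join of a set of congruences: the transitive closure of their union. -/
def AlgCon.chain (S : Set (AlgCon L A)) : AlgCon L A where
  r := Relation.ReflTransGen fun x y => ∃ c ∈ S, c.r x y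
  iseqv :=
    ⟨fun _ => .refl,
      fun h => by
        induction h with
        | refl => exact .refl
        | tail _ h ih =>
          obtain ⟨c, hc, h⟩ := h
          exact .head ⟨c, hc, c.iseqv.symm h⟩ ih,
      fun h h' => h.trans h'⟩
  compat := by
    classical
    intro n f x y h
    -- The arguments are changed one at a time, each along its own chain, since the chains for
    -- different arguments need not run in parallel.
    have key : ∀ s : Finset (Fin n), Relation.ReflTransGen (fun x y => ∃ c ∈ S, c.r x y)
        (Structure.funMap f x) (Structure.funMap f (s.piecewise y x)) := by
      intro s
      induction s using Finset.induction_on with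
      | empty => simpa using Relation.ReflTransGen.refl
      | insert i s hi ih =>
        refine ih.trans ?_
        have hx : s.piecewise y x = Function.update (s.piecewise y x) i (x i) := by
          rw [eq_comm, Function.update_eq_self_iff, Finset.piecewise_eq_of_notMem _ _ _ hi]
        rw [Finset.piecewise_insert, hx, Function.update_idem]
        refine Relation.ReflTransGen.lift
          (fun u => Structure.funMap f (Function.update (s.piecewise y x) i u)) ?_ _ _ (h i)
        rintro u v ⟨c, hc, huv⟩
        refine ⟨c, hc, c.compat f _ _ fun j => ?_⟩
        by_cases hj : j = i
        · subst hj; simpa using huv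
        · simp [hj]
    simpa using key Finset.univ

theorem AlgCon.le_chain {S : Set (AlgCon L A)} {c : AlgCon L A} (hc : c ∈ S) :
    c ≤ AlgCon.chain S :=
  AlgCon.le_iff.2 fun _ _ h => Relation.ReflTransGen.single ⟨c, hc, h⟩

variable {D : Type*} [DistribLattice D] [BoundedOrder D]

/-- If `Q` consists of irreducibles, `⊥` and `T`, and `T` corresponds to a principal congruence,
then `T` is the join of two elements of `J₀ D`. -/
theorem AlgRepresents.exists_sup_eq [Finite D] {T : D} (h : AlgRepresents L A (J₀ D ∪ {T})) :
    ∃ y ∈ J₀ D, ∃ z ∈ J₀ D, y ⊔ z = T := by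
  obtain ⟨φ, hφ⟩ := h
  have hmem : ∀ x y : A, φ (AlgCon.con L x y) ∈ J₀ D ∪ {T} := fun x y =>
    hφ ▸ ⟨_, AlgCon.con_mem_principal x y, rfl⟩
  have hT : T ∈ φ '' AlgCon.principal L A := hφ ▸ Or.inr rfl
  obtain ⟨c, ⟨a, b, hab⟩, rfl⟩ := hT
  obtain rfl : c = AlgCon.con L a b := hab.unique (AlgCon.isLeast_con a b)
  set T := φ (AlgCon.con L a b) with hT
  by_contra! hne
  let S : Set (AlgCon L A) := {c | φ c ∈ J₀ D ∧ φ c ≤ T}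
  have hle : AlgCon.con L a b ≤ AlgCon.chain S := by
    rw [← φ.le_iff_le]
    obtain ⟨s, hs, hs'⟩ := exists_supIrred_decomposition T
    rw [← hT, ← hs]
    refine Finset.sup_le fun p hp => ?_
    have : φ.symm p ∈ S := by
      refine ⟨by rw [φ.apply_symm_apply]; exact Or.inl (hs' hp), ?_⟩
      rw [φ.apply_symm_apply, ← hs]
      exact Finset.le_sup (f := id) hp
    simpa using φ.monotone (AlgCon.le_chain this)
  have key : ∀ y, (AlgCon.chain S).r a y →
      φ (AlgCon.con L a y) ∈ J₀ D ∧ φ (AlgCon.con L a y) ≤ T := by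
    intro y hy
    induction hy with
    | refl =>
      have : φ (AlgCon.con L a a) = ⊥ := by
        refine le_bot_iff.1 ?_
        rw [← φ.apply_symm_apply ⊥, φ.le_iff_le, AlgCon.con_le_iff]
      rw [this]
      exact ⟨Or.inr rfl, bot_le⟩
    | @tail x y _ hxy ih =>
      obtain ⟨c, hc, hxy⟩ := hxy
      have hstep : φ (AlgCon.con L a y) ≤ φ (AlgCon.con L a x) ⊔ φ c := by
        rw [← φ.apply_symm_apply (_ ⊔ _), φ.le_iff_le, AlgCon.con_le_iff]
        refine Setoid.trans' _ (y := x) ?_ ?_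
        · exact AlgCon.con_le_iff.1 ((φ.le_symm_apply).2 le_sup_left)
        · exact AlgCon.le_iff.1 ((φ.le_symm_apply).2 le_sup_right) _ _ hxy
      have hT' := hstep.trans (sup_le ih.2 hc.2)
      -- If `con(a, y)` were `T`, then `con(a, x)` and the step `c` would be two elements of `J₀ D`
      -- with join `T`.
      refine ⟨(hmem a y).resolve_right fun h => ?_, hT'⟩
      refine hne _ ih.1 _ hc.1 (le_antisymm (sup_le ih.2 hc.2) ?_)
      rwa [Set.mem_singleton_iff.1 h] at hstep
  exact hne _ (key b (AlgCon.con_le_iff.1 hle)).1 _ (key b (AlgCon.con_le_iff.1 hle)).1 (sup_idem _)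

/-- If all principal congruences are irreducible or trivial and `⊤` is a join of two elements of
`J₀ D`, then `⊤ ∈ J₀ D`: a set is not the union of two proper equivalence relations. -/
theorem AlgRepresents.top_mem_J₀ (h : AlgRepresents L A (J₀ D))
    {p q : D} (hp : p ∈ J₀ D) (hq : q ∈ J₀ D) (hpq : p ⊔ q = ⊤) : ⊤ ∈ J₀ D := by
  obtain ⟨φ, hφ⟩ := h
  have hmem : ∀ x y : A, (φ.symm p).r x y ∨ (φ.symm q).r x y := by
    intro x y
    have hxy : φ (AlgCon.con L x y) ∈ J₀ D := hφ ▸ ⟨_, AlgCon.con_mem_principal x y, rfl⟩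
    have : φ (AlgCon.con L x y) ≤ p ∨ φ (AlgCon.con L x y) ≤ q := by
      rcases hxy with hxy | hxy
      · exact (supPrime_iff_supIrred.2 hxy).2 (hpq ▸ le_top)
      · exact Or.inl ((Set.mem_singleton_iff.1 hxy) ▸ bot_le)
    simpa only [← φ.le_symm_apply, AlgCon.con_le_iff] using this
  have htop : ∀ d : D, (∀ x y, (φ.symm d).r x y) → d = ⊤ := fun d hd => by
    refine top_le_iff.1 (φ.symm.le_iff_le.1 (AlgCon.le_iff.2 fun x y _ => hd x y))
  by_contra hne
  have hp' : ∃ x y, ¬ (φ.symm p).r x y := by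
    by_contra! hall; exact hne (htop p hall ▸ hp)
  have hq' : ∃ x y, ¬ (φ.symm q).r x y := by
    by_contra! hall; exact hne (htop q hall ▸ hq)
  obtain ⟨x, y, hxy⟩ := hp'
  obtain ⟨u, v, huv⟩ := hq'
  have hqxy := (hmem x y).resolve_left hxy
  have hpuv := (hmem u v).resolve_right huv
  have symm_p := fun {a b : A} (h : (φ.symm p).r a b) => (φ.symm p).iseqv.symm h
  have trans_p := fun {a b c : A} (h : (φ.symm p).r a b) => (φ.symm p).iseqv.trans (z := c) h
  have symm_q := fun {a b : A} (h : (φ.symm q).r a b) => (φ.symm q).iseqv.symm h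
  have trans_q := fun {a b c : A} (h : (φ.symm q).r a b) => (φ.symm q).iseqv.trans (z := c) h
  -- `p` separates `x, y` and so relates `u, v`; `q` does the opposite. However the cross pairs are
  -- distributed, `p` links `x` to `y` or `q` links `u` to `v`.
  rcases hmem x u with hxu | hxu
  · rcases hmem y u with hyu | hyu
    · exact hxy (trans_p hxu (symm_p hyu))
    · rcases hmem y v with hyv | hyv
      · exact hxy (trans_p (trans_p hxu hpuv) (symm_p hyv))
      · exact huv (trans_q (symm_q hyu) hyv)
  · rcases hmem x v with hxv | hxv
    · rcases hmem y u with hyu | hyu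
      · exact hxy (trans_p hxv (trans_p (symm_p hpuv) (symm_p hyu)))
      · rcases hmem y v with hyv | hyv
        · exact hxy (trans_p hxv (symm_p hyv))
        · exact huv (trans_q (symm_q hyu) hyv)
    · exact huv (trans_q (symm_q hxu) hxv)

end Algebra

/-! ### Consequences of full A-representability for `D`. -/

section Consequences

variable {D : Type d} [DistribLattice D] [BoundedOrder D] [Finite D]

theorem FullyARepresentable.exists_sup_eq (h : FullyARepresentable.{u, w, d} D) (T : D) :
    ∃ y ∈ J₀ D, ∃ z ∈ J₀ D, y ⊔ z = T := by
  obtain ⟨L, _, A, _, _, hA⟩ := h (J₀ D ∪ {T}) Set.subset_union_left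
  exact hA.exists_sup_eq

theorem FullyARepresentable.top_mem_J₀ (h : FullyARepresentable.{u, w, d} D) :
    (⊤ : D) ∈ J₀ D := by
  obtain ⟨p, hp, q, hq, hpq⟩ := h.exists_sup_eq ⊤
  obtain ⟨L, _, A, _, _, hA⟩ := h (J₀ D) subset_rfl
  exact hA.top_mem_J₀ hp hq hpq

end Consequences

end PrincCong

namespace PrincCong

/-! ### The lattice of cells and its congruences `conOf d`. -/

section Cells

variable {V D : Type*} [Lattice D] [BoundedOrder D]

/-- The vertex sets that support cells: a vertex of colour `⊤` is isolated, and the colours of each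
finite subset have their join in `Q`. -/
def IsFace (col : V → D) (Q : Set D) (s : Set V) : Prop :=
  (∀ v ∈ s, col v = ⊤ → ∀ w ∈ s, w = v) ∧ ∀ r : Finset V, ↑r ⊆ s → r.sup col ∈ Q

theorem IsFace.mono {col : V → D} {Q : Set D} {s t : Set V} (hs : IsFace col Q s) (h : t ⊆ s) :
    IsFace col Q t :=
  ⟨fun v hv hc w hw => hs.1 v (h hv) hc w (h hw), fun r hr => hs.2 r (hr.trans h)⟩

theorem isFace_pair {col : V → D} {Q : Set D} {v w : V} (hv : col v ≠ ⊤) (hw : col w ≠ ⊤)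
    (hbot : ⊥ ∈ Q) (hvQ : col v ∈ Q) (hwQ : col w ∈ Q) (hvw : col v ⊔ col w ∈ Q) :
    IsFace col Q {v, w} := by
  classical
  refine ⟨fun x hx hc => ?_, fun r hr => ?_⟩
  · rcases hx with rfl | rfl <;> contradiction
  · have hr' : r ⊆ {v, w} := fun x hx => by simpa using hr hx
    by_cases h1 : v ∈ r <;> by_cases h2 : w ∈ r
    · have : r = {v, w} := hr'.antisymm (by simp [Finset.insert_subset_iff, h1, h2])
      simpa [this] using hvw
    · have : r = {v} := by ext x; have := @hr' x; grind
      simpa [this] using hvQ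
    · have : r = {w} := by ext x; have := @hr' x; grind
      simpa [this] using hwQ
    · have : r = ∅ := by ext x; have := @hr' x; grind
      simpa [this] using hbot

theorem isFace_singleton {col : V → D} {Q : Set D} (hbot : ⊥ ∈ Q) {v : V} (hv : col v ∈ Q) :
    IsFace col Q {v} := by
  refine ⟨by simp, fun r hr => ?_⟩
  rcases Finset.subset_singleton_iff.1 (show r ⊆ {v} by exact_mod_cast hr) with rfl | rfl
  · simpa using hbot
  · simpa using hv

/-- A proper element of the representing lattice: every vertex of the face `base` is at its lower
level or, if it belongs to `up`, at its upper level. Vertices of colour `⊤` have no upper level, and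
a raised vertex raises all vertices of smaller colour in the face. -/
@[ext]
structure Cell (col : V → D) (Q : Set D) where
  base : Set V
  up : Set V
  isFace : IsFace col Q base
  up_subset : up ⊆ base
  col_ne_top : ∀ v ∈ up, col v ≠ ⊤
  lower : ∀ v ∈ up, ∀ w ∈ base, col w ≤ col v → w ∈ up

namespace Cell

variable {col : V → D} {Q : Set D}

theorem prod_injective :
    Function.Injective (fun x : Cell col Q => (x.base, x.up)) := fun _ _ h =>
  Cell.ext (congrArg Prod.fst h) (congrArg Prod.snd h)

instance [Finite V] : Finite (Cell col Q) := Finite.of_injective _ prod_injective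

instance : PartialOrder (Cell col Q) := PartialOrder.lift _ prod_injective

theorem le_iff {x y : Cell col Q} : x ≤ y ↔ x.base ⊆ y.base ∧ x.up ⊆ y.up := Iff.rfl

instance : Min (Cell col Q) where
  min x y :=
    { base := x.base ∩ y.base
      up := x.up ∩ y.up
      isFace := x.isFace.mono Set.inter_subset_left
      up_subset := Set.inter_subset_inter x.up_subset y.up_subset
      col_ne_top := fun v hv => x.col_ne_top v hv.1
      lower := fun v hv w hw h => ⟨x.lower v hv.1 w hw.1 h, y.lower v hv.2 w hw.2 h⟩ }

@[simp] theorem base_inf (x y : Cell col Q) : (x ⊓ y).base = x.base ∩ y.base := rfl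

@[simp] theorem up_inf (x y : Cell col Q) : (x ⊓ y).up = x.up ∩ y.up := rfl

instance : SemilatticeInf (Cell col Q) where
  inf := (· ⊓ ·)
  inf_le_left _ _ := le_iff.2 ⟨Set.inter_subset_left, Set.inter_subset_left⟩
  inf_le_right _ _ := le_iff.2 ⟨Set.inter_subset_right, Set.inter_subset_right⟩
  le_inf _ _ _ h h' := le_iff.2 ⟨Set.subset_inter h.1 h'.1, Set.subset_inter h.2 h'.2⟩

/-- The join of two cells whose bases span a face. -/
def join (x y : Cell col Q) (h : IsFace col Q (x.base ∪ y.base)) : Cell col Q where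
  base := x.base ∪ y.base
  up := {w ∈ x.base ∪ y.base | ∃ v ∈ x.up ∪ y.up, col w ≤ col v}
  isFace := h
  up_subset _ hv := hv.1
  col_ne_top := by
    rintro w ⟨_, v, hv, hwv⟩ hw
    have hv' : col v = ⊤ := top_le_iff.1 (hw ▸ hwv)
    rcases hv with hv | hv
    · exact x.col_ne_top v hv hv'
    · exact y.col_ne_top v hv hv'
  lower := by
    rintro w ⟨_, v, hv, hwv⟩ w' hw' h
    exact ⟨hw', v, hv, h.trans hwv⟩

open Classical in
/-- The join in the lattice of cells with a top element adjoined. -/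
noncomputable def sup : WithTop (Cell col Q) → WithTop (Cell col Q) → WithTop (Cell col Q)
  | some x, some y => if h : IsFace col Q (x.base ∪ y.base) then some (x.join y h) else ⊤
  | _, _ => ⊤

theorem sup_coe_of_isFace {x y : Cell col Q} (h : IsFace col Q (x.base ∪ y.base)) :
    sup (x : WithTop (Cell col Q)) y = (x.join y h : Cell col Q) := dif_pos h

theorem sup_coe_of_not_isFace {x y : Cell col Q} (h : ¬ IsFace col Q (x.base ∪ y.base)) :
    sup (x : WithTop (Cell col Q)) y = ⊤ := dif_neg h

theorem sup_top (x : WithTop (Cell col Q)) : sup x ⊤ = ⊤ := by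
  cases x <;> rfl

theorem top_sup (x : WithTop (Cell col Q)) : sup ⊤ x = ⊤ := rfl

theorem left_le_join (x y : Cell col Q) (h : IsFace col Q (x.base ∪ y.base)) : x ≤ x.join y h :=
  ⟨Set.subset_union_left, fun v hv => ⟨Or.inl (x.up_subset hv), v, Or.inl hv, le_rfl⟩⟩

theorem right_le_join (x y : Cell col Q) (h : IsFace col Q (x.base ∪ y.base)) : y ≤ x.join y h :=
  ⟨Set.subset_union_right, fun v hv => ⟨Or.inr (y.up_subset hv), v, Or.inr hv, le_rfl⟩⟩

theorem join_le {x y z : Cell col Q} (h : IsFace col Q (x.base ∪ y.base)) (hx : x ≤ z)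
    (hy : y ≤ z) : x.join y h ≤ z := by
  have hb : x.base ∪ y.base ⊆ z.base := Set.union_subset hx.1 hy.1
  refine ⟨hb, ?_⟩
  rintro w ⟨hw, v, hv, hwv⟩
  exact z.lower v (hv.elim (fun h => hx.2 h) fun h => hy.2 h) w (hb hw) hwv

noncomputable instance : Lattice (WithTop (Cell col Q)) where
  __ := (inferInstance : SemilatticeInf (WithTop (Cell col Q)))
  sup := sup
  le_sup_left x y := by
    induction x with
    | top => exact le_top
    | coe x =>
      induction y with
      | top => exact le_top.trans_eq (sup_top _).symm
      | coe y =>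
        by_cases h : IsFace col Q (x.base ∪ y.base)
        · exact (WithTop.coe_le_coe.2 (left_le_join x y h)).trans_eq (sup_coe_of_isFace h).symm
        · exact le_top.trans_eq (sup_coe_of_not_isFace h).symm
  le_sup_right x y := by
    induction x with
    | top => exact le_top.trans_eq (top_sup _).symm
    | coe x =>
      induction y with
      | top => exact le_top.trans_eq (sup_top _).symm
      | coe y =>
        by_cases h : IsFace col Q (x.base ∪ y.base)
        · exact (WithTop.coe_le_coe.2 (right_le_join x y h)).trans_eq (sup_coe_of_isFace h).symm
        · exact le_top.trans_eq (sup_coe_of_not_isFace h).symm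
  sup_le x y z hx hy := by
    induction z with
    | top => exact le_top
    | coe z =>
      induction x with
      | top => exact absurd hx (WithTop.not_top_le_coe _)
      | coe x =>
        induction y with
        | top => exact absurd hy (WithTop.not_top_le_coe _)
        | coe y =>
          rw [WithTop.coe_le_coe] at hx hy
          have h : IsFace col Q (x.base ∪ y.base) :=
            z.isFace.mono (Set.union_subset hx.1 hy.1)
          exact (sup_coe_of_isFace h).trans_le (WithTop.coe_le_coe.2 (join_le h hx hy))

theorem coe_sup_coe {x y : Cell col Q} (h : IsFace col Q (x.base ∪ y.base)) :
    (x : WithTop (Cell col Q)) ⊔ y = (x.join y h : Cell col Q) := sup_coe_of_isFace h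

theorem coe_sup_coe_eq_top {x y : Cell col Q} (h : ¬ IsFace col Q (x.base ∪ y.base)) :
    (x : WithTop (Cell col Q)) ⊔ y = ⊤ := sup_coe_of_not_isFace h

/-- Two elements are related if they have the same base and agree in all vertices whose colour is
not below `d`; everything is related if `d = ⊤`. -/
def Rel (d : D) (x y : WithTop (Cell col Q)) : Prop :=
  d = ⊤ ∨ (x = ⊤ ∧ y = ⊤) ∨ ∃ a b : Cell col Q, x = a ∧ y = b ∧ a.base = b.base ∧
    ∀ v, ¬ col v ≤ d → (v ∈ a.up ↔ v ∈ b.up)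

theorem rel_coe_iff {d : D} {a b : Cell col Q} : Rel d (a : WithTop (Cell col Q)) b ↔
    d = ⊤ ∨ (a.base = b.base ∧ ∀ v, ¬ col v ≤ d → (v ∈ a.up ↔ v ∈ b.up)) := by
  simp [Rel]

theorem rel_top_coe_iff {d : D} {b : Cell col Q} :
    Rel d (⊤ : WithTop (Cell col Q)) b ↔ d = ⊤ := by
  simp [Rel]

theorem rel_coe_top_iff {d : D} {b : Cell col Q} :
    Rel d (b : WithTop (Cell col Q)) ⊤ ↔ d = ⊤ := by
  simp [Rel]

/-- A vertex whose colour is not below `d` can only be raised by a vertex whose colour is not below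
`d` either, and there the cells agree. -/
theorem join_up_subset {d : D} {a b a' b' : Cell col Q} {h : IsFace col Q (a.base ∪ a'.base)}
    {h' : IsFace col Q (b.base ∪ b'.base)} (hab : a.base = b.base) (hab' : a'.base = b'.base)
    (hu : ∀ v, ¬ col v ≤ d → (v ∈ a.up ↔ v ∈ b.up))
    (hu' : ∀ v, ¬ col v ≤ d → (v ∈ a'.up ↔ v ∈ b'.up)) {w : V} (hw : ¬ col w ≤ d)
    (hwa : w ∈ (a.join a' h).up) : w ∈ (b.join b' h').up := by
  obtain ⟨hb, v, hv, hwv⟩ := hwa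
  have hvd : ¬ col v ≤ d := fun h => hw (hwv.trans h)
  exact ⟨by rwa [← hab, ← hab'], v, hv.imp (hu v hvd).1 (hu' v hvd).1, hwv⟩

/-- The congruence attached to an element `d` of `D`. -/
def conOf (d : D) : LatticeCon (WithTop (Cell col Q)) where
  r := Rel d
  iseqv :=
    { refl := fun x => by induction x <;> simp [Rel]
      symm := by
        rintro x y (h | ⟨hx, hy⟩ | ⟨a, b, hx, hy, hb, hu⟩)
        · exact Or.inl h
        · exact Or.inr (Or.inl ⟨hy, hx⟩)
        · exact Or.inr (Or.inr ⟨b, a, hy, hx, hb.symm, fun v hv => (hu v hv).symm⟩)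
      trans := by
        rintro x y z (h | ⟨hx, rfl⟩ | ⟨a, b, hx, rfl, hb, hu⟩)
          (h' | ⟨hy, hz⟩ | ⟨a', b', hy, hz, hb', hu'⟩)
        all_goals first | exact Or.inl ‹_› | skip
        · exact Or.inr (Or.inl ⟨hx, hz⟩)
        · simp at hy
        · simp at hy
        · obtain rfl := WithTop.coe_injective hy
          exact Or.inr (Or.inr ⟨a, b', hx, hz, hb.trans hb', fun v hv =>
            (hu v hv).trans (hu' v hv)⟩) }
  inf := by
    rintro w x y z (h | ⟨rfl, rfl⟩ | ⟨a, b, rfl, rfl, hb, hu⟩)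
      (h' | ⟨rfl, rfl⟩ | ⟨a', b', rfl, rfl, hb', hu'⟩)
    all_goals first | exact Or.inl ‹_› | skip
    · exact Or.inr (Or.inl (by simp))
    · rw [top_inf_eq, top_inf_eq]
      exact Or.inr (Or.inr ⟨_, _, rfl, rfl, hb', hu'⟩)
    · rw [inf_top_eq, inf_top_eq]
      exact Or.inr (Or.inr ⟨_, _, rfl, rfl, hb, hu⟩)
    · refine Or.inr (Or.inr ⟨a ⊓ a', b ⊓ b', rfl, rfl, by simp [hb, hb'], fun v hv => ?_⟩)
      simp [hu v hv, hu' v hv]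
  sup := by
    rintro w x y z (h | ⟨rfl, rfl⟩ | ⟨a, b, rfl, rfl, hb, hu⟩)
      (h' | ⟨rfl, rfl⟩ | ⟨a', b', rfl, rfl, hb', hu'⟩)
    all_goals first | exact Or.inl ‹_› | skip
    · exact Or.inr (Or.inl (by simp))
    · exact Or.inr (Or.inl (by simp))
    · exact Or.inr (Or.inl (by simp))
    · by_cases h : IsFace col Q (a.base ∪ a'.base)
      · have h' : IsFace col Q (b.base ∪ b'.base) := by rwa [← hb, ← hb']
        rw [coe_sup_coe h, coe_sup_coe h']
        refine Or.inr (Or.inr ⟨_, _, rfl, rfl, by simp [join, hb, hb'], fun v hv =>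
          ⟨join_up_subset hb hb' hu hu' hv, join_up_subset hb.symm hb'.symm
            (fun v hv => (hu v hv).symm) (fun v hv => (hu' v hv).symm) hv⟩⟩)
      · have h' : ¬ IsFace col Q (b.base ∪ b'.base) := by rwa [← hb, ← hb']
        exact Or.inr (Or.inl ⟨coe_sup_coe_eq_top h, coe_sup_coe_eq_top h'⟩)

end Cell

end Cells

end PrincCong

namespace PrincCong

/-! ### How an arbitrary congruence acts on cells. -/

section Congruences

variable {V D : Type*} [Lattice D] [BoundedOrder D] {col : V → D} {Q : Set D}

namespace Cell

/-- The cell on a face with all vertices at their lower level. -/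
def low (s : Set V) (hs : IsFace col Q s) : Cell col Q where
  base := s
  up := ∅
  isFace := hs
  up_subset := Set.empty_subset _
  col_ne_top := by simp
  lower := by simp

/-- The cell on a face with all vertices at their upper level. -/
def high (s : Set V) (hs : IsFace col Q s) (ht : ∀ v ∈ s, col v ≠ ⊤) : Cell col Q where
  base := s
  up := s
  isFace := hs
  up_subset := subset_rfl
  col_ne_top := ht
  lower := fun _ _ _ hw _ => hw

variable {c : LatticeCon (WithTop (Cell col Q))}

/-- Vertices of colour `⊤` are isolated, so a face contains at most one of the three. -/
theorem exists_top_notMem {u : Fin 3 → V} (hu : Function.Injective u) (hcu : ∀ i, col (u i) = ⊤)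
    {s : Set V} (hs : IsFace col Q s) : ∃ i j, i ≠ j ∧ u i ∉ s ∧ u j ∉ s := by
  by_cases h : ∃ i, u i ∈ s
  · obtain ⟨i, hi⟩ := h
    have key : ∀ j, j ≠ i → u j ∉ s := fun j hj hjs => hj (hu (hs.1 _ hi (hcu i) _ hjs))
    exact ⟨i + 1, i + 2, by simp, key _ (by simp), key _ (by simp)⟩
  · push Not at h
    exact ⟨0, 1, by simp, h 0, h 1⟩

/-- Meeting with `{v}` for `v` outside the base gives `∅ ~ {v}`. Two such vertices of colour `⊤`
span no face, so joining gives `∅ ~ ⊤`, and `∅` is the least element. -/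
theorem rel_of_rel_top (hsing : ∀ v, IsFace col Q {v}) {u : Fin 3 → V} (hu : Function.Injective u)
    (hcu : ∀ i, col (u i) = ⊤) {a : Cell col Q} (h : c.r a ⊤) (x y : WithTop (Cell col Q)) :
    c.r x y := by
  obtain ⟨i, j, hij, hi, hj⟩ := exists_top_notMem hu hcu a.isFace
  have hempty : IsFace col Q ∅ := a.isFace.mono (Set.empty_subset _)
  have key : ∀ v, v ∉ a.base → c.r (low ∅ hempty) (low {v} (hsing v)) := by
    intro v hv
    have := c.inf h (c.iseqv.refl (low {v} (hsing v) : WithTop (Cell col Q)))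
    rw [top_inf_eq, ← WithTop.coe_inf] at this
    convert this using 2
    ext w <;> simp [low]
    rintro hw rfl
    exact hv hw
  have hbot : c.r (low ∅ hempty) ⊤ := by
    have := c.sup (key _ hi) (key _ hj)
    rw [sup_idem] at this
    convert this using 1
    refine (coe_sup_coe_eq_top fun hf => hij (hu ?_)).symm
    exact hf.1 (u j) (Or.inr rfl) (hcu j) _ (Or.inl rfl)
  have hx : ∀ x, c.r (low ∅ hempty) x := fun x => by
    have := c.inf hbot (c.iseqv.refl x)
    rw [top_inf_eq] at this
    convert this using 1
    refine (inf_eq_left.2 ?_).symm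
    induction x with
    | top => exact le_top
    | coe x => exact WithTop.coe_le_coe.2 ⟨Set.empty_subset _, Set.empty_subset _⟩
  exact c.iseqv.trans (c.iseqv.symm (hx x)) (hx y)

/-- Meeting with `{w}` gives `∅ ~ {w}`; joining with an isolated vertex other than `w` relates that
vertex to `⊤`. -/
theorem rel_of_mem_base (hsing : ∀ v, IsFace col Q {v}) {u : Fin 3 → V} (hu : Function.Injective u)
    (hcu : ∀ i, col (u i) = ⊤) {a b : Cell col Q} (h : c.r a b) {w : V} (hwa : w ∉ a.base)
    (hwb : w ∈ b.base) (x y : WithTop (Cell col Q)) : c.r x y := by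
  obtain ⟨i, -, -, hi, -⟩ := exists_top_notMem hu hcu (hsing w)
  have hempty : IsFace col Q ∅ := a.isFace.mono (Set.empty_subset _)
  have h1 : c.r (low ∅ hempty) (low {w} (hsing w)) := by
    have := c.inf h (c.iseqv.refl (low {w} (hsing w) : WithTop (Cell col Q)))
    rw [← WithTop.coe_inf, ← WithTop.coe_inf] at this
    convert this using 2
    · ext v <;> simp [low]
      rintro hv rfl
      exact hwa hv
    · ext v <;> simp [low]
      rintro rfl
      exact hwb
  have h2 := c.sup h1 (c.iseqv.refl (low {u i} (hsing _) : WithTop (Cell col Q)))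
  rw [coe_sup_coe_eq_top (x := low {w} (hsing w)) (y := low {u i} (hsing _))
    (fun hf => hi (hf.1 (u i) (Or.inr rfl) (hcu i) w (Or.inl rfl)).symm)] at h2
  have hf : IsFace col Q ((low ∅ hempty : Cell col Q).base ∪ (low {u i} (hsing _)).base) := by
    simpa [low] using hsing (u i)
  rw [coe_sup_coe hf] at h2
  exact rel_of_rel_top hsing hu hcu h2 x y

theorem base_eq (hsing : ∀ v, IsFace col Q {v}) {u : Fin 3 → V} (hu : Function.Injective u)
    (hcu : ∀ i, col (u i) = ⊤) (hc : ¬ ∀ x y, c.r x y) {a b : Cell col Q} (h : c.r a b) :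
    a.base = b.base := by
  ext w
  by_contra hw
  by_cases hwa : w ∈ a.base <;> by_cases hwb : w ∈ b.base <;> simp only [hwa, hwb, iff_true,
    not_true, iff_false, not_false_iff] at hw
  · exact hc (rel_of_mem_base hsing hu hcu (c.iseqv.symm h) hwb hwa)
  · exact hc (rel_of_mem_base hsing hu hcu h hwa hwb)

/-- The vertices whose two levels are identified by `c`. -/
def collapsed (hsing : ∀ v, IsFace col Q {v}) (c : LatticeCon (WithTop (Cell col Q))) : Set V :=
  {v | ∃ hv : col v ≠ ⊤, c.r (low {v} (hsing v)) (high {v} (hsing v) (by simpa using hv))}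

/-- On the edge `{v, w}`, raising `v` also raises `w`; a meet with the raised `{w}` then forgets
`v`. -/
theorem mem_collapsed_of_le (hsing : ∀ v, IsFace col Q {v}) (hbot : ⊥ ∈ Q)
    (hQ : ∀ v, col v ∈ Q) {v w : V} (hv : v ∈ collapsed hsing c) (h : col w ≤ col v) :
    w ∈ collapsed hsing c := by
  obtain ⟨hv, hc⟩ := hv
  have hw : col w ≠ ⊤ := fun hw => hv (top_le_iff.1 (hw ▸ h))
  have hf : IsFace col Q ({v} ∪ {w}) :=
    isFace_pair hv hw hbot (hQ v) (hQ w) (by rw [sup_eq_left.2 h]; exact hQ v)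
  refine ⟨hw, ?_⟩
  have h1 := c.sup hc (c.iseqv.refl (low {w} (hsing w) : WithTop (Cell col Q)))
  rw [coe_sup_coe (x := low {v} (hsing v)) (y := low {w} (hsing w)) hf,
    coe_sup_coe (x := high {v} (hsing v) (by simpa using hv)) (y := low {w} (hsing w)) hf] at h1
  have h2 := c.inf h1
    (c.iseqv.refl (high {w} (hsing w) (by simpa using hw) : WithTop (Cell col Q)))
  rw [← WithTop.coe_inf, ← WithTop.coe_inf] at h2
  convert h2 using 2
  · ext x <;> simp [low, high, join]
  · ext x <;> simp [low, high, join]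
    rintro rfl; exact ⟨Or.inl rfl, h⟩

/-- Meeting with the raised `{v}` isolates the disagreement at `v`. -/
theorem mem_collapsed_of_rel (hsing : ∀ v, IsFace col Q {v}) {a b : Cell col Q}
    (hab : a.base = b.base) (h : c.r a b) {v : V} (hva : v ∉ a.up) (hvb : v ∈ b.up) :
    v ∈ collapsed hsing c := by
  have hv := b.col_ne_top v hvb
  refine ⟨hv, ?_⟩
  have h1 := c.inf h
    (c.iseqv.refl (high {v} (hsing v) (by simpa using hv) : WithTop (Cell col Q)))
  rw [← WithTop.coe_inf, ← WithTop.coe_inf] at h1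
  have hvb' := b.up_subset hvb
  convert h1 using 2
  · ext x <;> simp [low, high]
    · rintro rfl; rwa [hab]
    · rintro hx rfl; exact hva hx
  · ext x <;> simp [high]
    · rintro rfl; exact hvb'
    · rintro rfl; exact hvb

/-- Vertices are raised one at a time by joining with the raised `{v}`; the result stays below `b`.
-/
theorem rel_of_le (hsing : ∀ v, IsFace col Q {v}) [Finite V] {a b : Cell col Q} (hle : a ≤ b)
    (hab : a.base = b.base) (h : ∀ v ∈ b.up, v ∉ a.up → v ∈ collapsed hsing c) :
    c.r a b := by
  classical
  have key : ∀ r : Finset V, ↑r ⊆ b.up → ∃ x : Cell col Q, c.r a x ∧ a ≤ x ∧ x ≤ b ∧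
      ↑r ⊆ x.up := by
    intro r
    induction r using Finset.induction_on with
    | empty => exact fun _ => ⟨a, c.iseqv.refl _, le_rfl, hle, by simp⟩
    | insert v r _ ih =>
      intro hr
      rw [Finset.coe_insert, Set.insert_subset_iff] at hr
      obtain ⟨x, hax, hle, hxb, hx⟩ := ih hr.2
      by_cases hva : v ∈ a.up
      · exact ⟨x, hax, hle, hxb, by
          rw [Finset.coe_insert, Set.insert_subset_iff]; exact ⟨hle.2 hva, hx⟩⟩
      obtain ⟨hv, hvc⟩ := h v hr.1 hva
      have hvx : {v} ⊆ x.base := by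
        rw [Set.singleton_subset_iff]
        exact (le_iff.1 hle).1 (hab ▸ b.up_subset hr.1)
      have hf : IsFace col Q (x.base ∪ {v}) := by
        rw [Set.union_eq_left.2 hvx]; exact x.isFace
      have h1 := c.sup (c.iseqv.refl (x : WithTop (Cell col Q))) hvc
      rw [coe_sup_coe (y := high {v} (hsing v) (by simpa using hv)) hf, sup_eq_left.2
        (WithTop.coe_le_coe.2 (le_iff.2 ⟨hvx, Set.empty_subset _⟩))] at h1
      have hxj := left_le_join x (high {v} (hsing v) (by simpa using hv)) hf
      have hvj := right_le_join x (high {v} (hsing v) (by simpa using hv)) hf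
      refine ⟨_, c.iseqv.trans hax h1, hle.trans hxj, join_le hf hxb ?_, ?_⟩
      · exact ⟨hvx.trans hxb.1, Set.singleton_subset_iff.2 hr.1⟩
      · rw [Finset.coe_insert, Set.insert_subset_iff]
        exact ⟨hvj.2 rfl, hx.trans hxj.2⟩
  obtain ⟨x, hax, hle', hxb, hx⟩ := key b.up.toFinite.toFinset (by simp)
  have : x = b := le_antisymm hxb (le_iff.2 ⟨hab ▸ (le_iff.1 hle').1, by simpa using hx⟩)
  exact this ▸ hax

end Cell

end Congruences

/-! ### The congruence lattice is `D`, and the principal congruences form `Q`. -/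

section Representation

variable {V D : Type*} [DistribLattice D] [BoundedOrder D] {col : V → D} {Q : Set D}

open Cell

theorem exists_conOf_eq [Finite V] (hcol : ∀ v, SupIrred (col v)) (htop : SupIrred (⊤ : D))
    (hQ : JPlus D ⊆ Q) {u : Fin 3 → V} (hu : Function.Injective u) (hcu : ∀ i, col (u i) = ⊤)
    (c : LatticeCon (WithTop (Cell col Q))) : ∃ d, conOf d = c := by
  classical
  have := Fintype.ofFinite V
  have hbot : ⊥ ∈ Q := hQ (by simp [JPlus])
  have hcQ : ∀ v, col v ∈ Q := fun v => hQ (Or.inl (hcol v))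
  have hsing : ∀ v, IsFace col Q {v} := fun v => isFace_singleton hbot (hcQ v)
  suffices ∃ d : D, ∀ x y, Rel d x y ↔ c.r x y by
    obtain ⟨d, hd⟩ := this
    exact ⟨d, latticeCon_toSetoid_injective (Setoid.ext hd)⟩
  by_cases hc : ∀ x y, c.r x y
  · exact ⟨⊤, fun x y => ⟨fun _ => hc x y, fun _ => Or.inl rfl⟩⟩
  -- Colours are join-prime, so a colour below this join is below a collapsed colour, and its vertex
  -- is collapsed too.
  set d := (Finset.univ.filter (· ∈ collapsed hsing c)).sup col with hd
  have hmem : ∀ v, col v ≤ d ↔ v ∈ collapsed hsing c := by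
    refine fun v => ⟨fun hv => ?_, fun hv => Finset.le_sup (by simpa using hv)⟩
    obtain ⟨w, hw, hvw⟩ := (supPrime_iff_supIrred.2 (hcol v)).le_finset_sup.1 hv
    exact mem_collapsed_of_le hsing hbot hcQ (by simpa using hw) hvw
  -- `⊤` is prime as well, and a vertex of colour `⊤` has no upper level to collapse.
  have hdtop : d ≠ ⊤ := by
    intro h
    obtain ⟨w, hw, hvw⟩ := (supPrime_iff_supIrred.2 htop).le_finset_sup.1 (hd ▸ h.ge)
    obtain ⟨hw, -⟩ : w ∈ collapsed hsing c := by simpa using hw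
    exact hw (top_le_iff.1 hvw)
  refine ⟨d, fun x y => ?_⟩
  induction x with
  | top =>
    induction y with
    | top => exact ⟨fun _ => c.iseqv.refl _, fun _ => (conOf d).iseqv.refl _⟩
    | coe b =>
      rw [rel_top_coe_iff]
      exact ⟨fun h => absurd h hdtop, fun h =>
        absurd (rel_of_rel_top hsing hu hcu (c.iseqv.symm h)) hc⟩
  | coe a =>
    induction y with
    | top =>
      rw [rel_coe_top_iff]
      exact ⟨fun h => absurd h hdtop, fun h => absurd (rel_of_rel_top hsing hu hcu h) hc⟩
    | coe b =>
      rw [rel_coe_iff, or_iff_right hdtop]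
      simp only [hmem]
      refine ⟨fun ⟨hb, h⟩ => ?_, fun h => ?_⟩
      · have h1 : c.r (a ⊓ b : Cell col Q) a := by
          refine rel_of_le hsing inf_le_left (by simp [hb]) fun v hv hv' => ?_
          by_contra hcon
          exact hv' ⟨hv, (h v hcon).1 hv⟩
        have h2 : c.r (a ⊓ b : Cell col Q) b := by
          refine rel_of_le hsing inf_le_right (by simp [hb]) fun v hv hv' => ?_
          by_contra hcon
          exact hv' ⟨(h v hcon).2 hv, hv⟩
        exact c.iseqv.trans (c.iseqv.symm h1) h2
      · have hb := base_eq hsing hu hcu hc h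
        refine ⟨hb, fun v hv => ⟨fun hva => ?_, fun hvb => ?_⟩⟩
        · by_contra hvb
          exact hv (mem_collapsed_of_rel hsing hb.symm (c.iseqv.symm h) hvb hva)
        · by_contra hva
          exact hv (mem_collapsed_of_rel hsing hb h hva hvb)

/-- For `d ≠ ⊤`, an irreducible `p ≤ d` is detected by the two levels of a single vertex of colour
`p`. -/
theorem conOf_le_conOf_iff [Finite D] (hcol : ∀ p : D, SupIrred p → ∃ v, col v = p)
    (htop : SupIrred (⊤ : D)) (hQ : JPlus D ⊆ Q) {d d' : D} :
    (conOf d : LatticeCon (WithTop (Cell col Q))) ≤ conOf d' ↔ d ≤ d' := by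
  have hbot : ⊥ ∈ Q := hQ (by simp [JPlus])
  constructor
  · intro h
    have h : ∀ x y : WithTop (Cell col Q), Rel d x y → Rel d' x y := fun x y hxy => h hxy
    by_cases hd' : d' = ⊤
    · exact hd' ▸ le_top
    by_cases hd : d = ⊤
    · obtain ⟨v, hv⟩ := hcol ⊤ htop
      have hf : IsFace col Q {v} := isFace_singleton hbot (hv ▸ hQ (by simp [JPlus]))
      exact absurd (rel_top_coe_iff.1 (h ⊤ (low {v} hf) (Or.inl hd))) hd'
    obtain ⟨s, rfl, hs⟩ := exists_supIrred_decomposition d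
    refine Finset.sup_le fun p hp => ?_
    obtain ⟨v, hv⟩ := hcol p (hs hp)
    have hple : p ≤ s.sup id := Finset.le_sup (f := id) hp
    have hv' : col v ≠ ⊤ := fun hv' => hd (top_le_iff.1 (hv'.symm.trans hv ▸ hple))
    have hf : IsFace col Q {v} := isFace_singleton hbot (hQ (Or.inl (hv ▸ hs hp)))
    have := h (low {v} hf) (high {v} hf (by simpa using hv')) (rel_coe_iff.2 (Or.inr ⟨rfl, by
      intro w hw
      have : w ≠ v := fun h => hw (by rwa [h, hv])
      simpa [low, high] using this⟩))
    rw [rel_coe_iff, or_iff_right hd'] at this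
    by_contra hcon
    simpa [low, high] using this.2 v (by rwa [hv])
  · rintro h x y (hd | hxy | ⟨a, b, hx, hy, hb, hu⟩)
    · exact Or.inl (top_le_iff.1 (hd ▸ h))
    · exact Or.inr (Or.inl hxy)
    · exact Or.inr (Or.inr ⟨a, b, hx, hy, hb, fun v hv => hu v fun h' => hv (h'.trans h)⟩)

/-- Every principal congruence lies in `Q`: on a common base the generator is the join of the
colours at which the cells differ, and the face condition covers this subset of the base. All other
pairs give `⊥` or `⊤`. -/
theorem exists_forall_rel_iff [Finite V] (hQ : JPlus D ⊆ Q) (x y : WithTop (Cell col Q)) :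
    ∃ d ∈ Q, ∀ d', Rel d' x y ↔ d ≤ d' := by
  classical
  have := Fintype.ofFinite V
  have hbot : ⊥ ∈ Q := hQ (by simp [JPlus])
  have htop : ⊤ ∈ Q := hQ (by simp [JPlus])
  induction x with
  | top =>
    induction y with
    | top => exact ⟨⊥, hbot, fun d' => by simp [Cell.Rel]⟩
    | coe b => exact ⟨⊤, htop, fun d' => by rw [rel_top_coe_iff, top_le_iff]⟩
  | coe a =>
    induction y with
    | top => exact ⟨⊤, htop, fun d' => by rw [rel_coe_top_iff, top_le_iff]⟩
    | coe b =>
      by_cases hb : a.base = b.base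
      · refine ⟨(Finset.univ.filter fun v => ¬ (v ∈ a.up ↔ v ∈ b.up)).sup col,
          a.isFace.2 _ ?_, fun d' => ?_⟩
        · intro v hv
          have hv : ¬ (v ∈ a.up ↔ v ∈ b.up) := by simpa using hv
          by_contra hva
          exact hv ⟨fun h => absurd (a.up_subset h) hva,
            fun h => absurd (hb ▸ b.up_subset h) hva⟩
        · rw [rel_coe_iff, Finset.sup_le_iff]
          refine ⟨?_, fun h => Or.inr ⟨hb, fun v hv => ?_⟩⟩
          · rintro (rfl | ⟨-, h⟩) v hv
            · exact le_top
            · by_contra hcon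
              exact (Finset.mem_filter.1 hv).2 (h v hcon)
          · by_contra hcon
            exact hv (h v (by simpa using hcon))
      · exact ⟨⊤, htop, fun d' => by simp [rel_coe_iff, hb]⟩

/-- Every `d ∈ Q` is principal. Because `d` is a join of at most two irreducibles, an edge suffices
as the face; it is a face precisely because `d ∈ Q`. -/
theorem exists_rel_iff_of_mem (hcol : ∀ p : D, SupIrred p → ∃ v, col v = p)
    (htop : SupIrred (⊤ : D)) (hQ : JPlus D ⊆ Q)
    (hsup : ∀ T : D, ∃ y ∈ J₀ D, ∃ z ∈ J₀ D, y ⊔ z = T) {d : D} (hd : d ∈ Q) :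
    ∃ x y : WithTop (Cell col Q), ∀ d', Rel d' x y ↔ d ≤ d' := by
  have hbot : ⊥ ∈ Q := hQ (by simp [JPlus])
  by_cases hdt : d = ⊤
  · obtain ⟨v, hv⟩ := hcol ⊤ htop
    have hf : IsFace col Q {v} := isFace_singleton hbot (hv ▸ hQ (by simp [JPlus]))
    exact ⟨⊤, low {v} hf, fun d' => by rw [rel_top_coe_iff, hdt, top_le_iff]⟩
  by_cases hdb : d = ⊥
  · exact ⟨⊤, ⊤, fun d' => by simp [Cell.Rel, hdb]⟩
  obtain ⟨p, q, hp, hq, rfl⟩ : ∃ p q : D, SupIrred p ∧ SupIrred q ∧ p ⊔ q = d := by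
    obtain ⟨p, hp, q, hq, rfl⟩ := hsup d
    rcases hp with hp | rfl <;> rcases hq with hq | rfl
    · exact ⟨p, q, hp, hq, rfl⟩
    · exact ⟨p, p, hp, hp, by simp⟩
    · exact ⟨q, q, hq, hq, by simp⟩
    · simp at hdb
  obtain ⟨v, rfl⟩ := hcol p hp
  obtain ⟨w, rfl⟩ := hcol q hq
  have hv : col v ≠ ⊤ := fun h => hdt (by simp [h])
  have hw : col w ≠ ⊤ := fun h => hdt (by simp [h])
  have hf : IsFace col Q {v, w} := isFace_pair hv hw hbot (hQ (Or.inl hp)) (hQ (Or.inl hq)) hd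
  refine ⟨low {v, w} hf, high {v, w} hf (by rintro x (rfl | rfl) <;> assumption), fun d' => ?_⟩
  rw [rel_coe_iff]
  constructor
  · rintro (rfl | ⟨-, h⟩)
    · exact le_top
    · refine sup_le ?_ ?_ <;> by_contra hcon
      · simpa [low, high] using h v hcon
      · simpa [low, high] using h w hcon
  · intro h
    refine Or.inr ⟨rfl, fun x hx => ?_⟩
    have h1 : x ≠ v := fun e => hx (e ▸ le_sup_left.trans h)
    have h2 : x ≠ w := fun e => hx (e ▸ le_sup_right.trans h)
    simp [low, high, h1, h2]

/-- If `⊤` is irreducible and every element of `D` is a join of two elements of `J₀ D`, then the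
lattice of cells represents `Q ⊆ D`. -/
theorem latticeRepresents_cell [Finite V] [Finite D] (hcol : ∀ v, SupIrred (col v))
    (hsurj : ∀ p : D, SupIrred p → ∃ v, col v = p) (htop : SupIrred (⊤ : D)) (hQ : JPlus D ⊆ Q)
    {u : Fin 3 → V} (hu : Function.Injective u) (hcu : ∀ i, col (u i) = ⊤)
    (hsup : ∀ T : D, ∃ y ∈ J₀ D, ∃ z ∈ J₀ D, y ⊔ z = T) :
    LatticeRepresents (WithTop (Cell col Q)) Q := by
  let ψ : D ≃o LatticeCon (WithTop (Cell col Q)) :=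
    RelIso.ofSurjective (OrderEmbedding.ofMapLEIff conOf fun _ _ =>
      conOf_le_conOf_iff hsurj htop hQ) (exists_conOf_eq hcol htop hQ hu hcu)
  have hψ : ∀ d x y, (ψ d).r x y ↔ Rel d x y := fun _ _ _ => Iff.rfl
  refine ⟨ψ.symm, Set.ext fun d => ⟨fun hd => ?_, ?_⟩⟩
  · obtain ⟨x, y, h⟩ := exists_rel_iff_of_mem (col := col) hsurj htop hQ hsup hd
    refine ⟨ψ d, ⟨x, y, (hψ _ _ _).2 ((h d).2 le_rfl), fun c hc => ?_⟩, ψ.symm_apply_apply d⟩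
    obtain ⟨d', rfl⟩ := ψ.surjective c
    exact ψ.monotone ((h d').1 ((hψ _ _ _).1 hc))
  · rintro ⟨c, ⟨x, y, hc, hmin⟩, rfl⟩
    obtain ⟨d, rfl⟩ := ψ.surjective c
    rw [ψ.symm_apply_apply]
    obtain ⟨e, he, h⟩ := exists_forall_rel_iff hQ x y
    have h1 : e ≤ d := (h d).1 ((hψ _ _ _).1 hc)
    have h2 : d ≤ e := ψ.le_iff_le.1 (hmin ((hψ _ _ _).2 ((h e).2 le_rfl)))
    exact le_antisymm h1 h2 ▸ he

theorem latticeRepresents_pUnit [Subsingleton D] (hQ : JPlus D ⊆ Q) :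
    LatticeRepresents PUnit.{1} Q := by
  have hsub : Subsingleton (LatticeCon PUnit.{1}) := ⟨fun c c' =>
    latticeCon_toSetoid_injective (Setoid.ext fun x y =>
      ⟨fun _ => c'.iseqv.refl _, fun _ => c.iseqv.refl _⟩)⟩
  let c₀ : LatticeCon PUnit.{1} := ⟨⊤, fun _ _ => trivial, fun _ _ => trivial⟩
  refine ⟨⟨⟨fun _ => ⊥, fun _ => c₀, fun _ => Subsingleton.elim _ _,
    fun _ => Subsingleton.elim _ _⟩, ?_⟩, ?_⟩
  · intro c c'
    simp [Subsingleton.elim c c']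
  · have hQ' : Q = Set.univ := Set.eq_univ_of_forall fun d =>
      hQ (Subsingleton.elim ⊥ d ▸ by simp [JPlus])
    rw [hQ', eq_comm]
    refine Set.eq_univ_of_forall fun d => ⟨c₀, ⟨⟨⟩, ⟨⟩, c₀.iseqv.refl PUnit.unit, fun c _ =>
      (Subsingleton.elim c₀ c).le⟩, Subsingleton.elim _ _⟩

end Representation

end PrincCong

theorem corollary1p4 (D : Type d) [DistribLattice D] [BoundedOrder D] [Finite D]
    (hD : PrincCong.FullyARepresentable.{u, w, d} D) : PrincCong.FullyFLRepresentable.{d} D := by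
  intro Q hQ
  rcases hD.top_mem_J₀ with htop | htop
  · obtain ⟨n, ⟨e⟩⟩ := Finite.exists_equiv_fin {p : D // SupIrred p}
    -- Three vertices per irreducible provide three vertices of colour `⊤`, so that every face
    -- misses two of them.
    let col : Fin n × Fin 3 → D := fun v => e.symm v.1
    refine ⟨WithTop (PrincCong.Cell col Q), inferInstanceAs (Finite (Option _)), ⟨⊤⟩,
      inferInstance, ?_⟩
    exact PrincCong.latticeRepresents_cell (u := fun i => (e ⟨⊤, htop⟩, i))
      (fun v => (e.symm v.1).2) (fun p hp => ⟨(e ⟨p, hp⟩, 0), by simp [col]⟩) htop hQ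
      (fun i j h => by simpa using h) (fun i => by simp [col]) hD.exists_sup_eq
  -- Here `⊤` is in `J₀ D` only as `⊥`, so `D` has one element.
  · have : Subsingleton D := subsingleton_of_bot_eq_top (Set.mem_singleton_iff.1 htop).symm
    exact ⟨PUnit, inferInstance, inferInstance, inferInstance,
      PrincCong.latticeRepresents_pUnit hQ⟩
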